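/- Let $\mathbb{M}_2$ be the algebra of complex $2\times 2$ matrices and let $\mathbb{P}_2\subset\mathbb{M}_2$ be the set of all positive definite $2\times 2$ complex matrices, with the topology inherited from any norm on $\mathbb{M}_2$. Let $\phi:\mathbb{P}_2\to\mathbb{P}_2$ be a continuous Jordan triple endomorphism, i.e. a continuous map with $\phi(ABA)=\phi(A)\phi(B)\phi(A)$ for all $A,B\in\mathbb{P}_2$. Then at least one of the following holds: (b1) there are a unitary matrix $U\in\mathbb{M}_2$ and a real number $c$ such that $\phi(A)=(\det A)^{c}\,UAU^*$ for all $A\in\mathbb{P}_2$; (b2) there are a unitary matrix $V\in\mathbb{M}_2$ and a real number $d$ such that $\phi(A)=(\det A)^{d}\,VA^{-1}V^*$ for all $A\in\mathbb{P}_2$; (b3) there are a unitary matrix $W\in\mathbb{M}_2$ and real numbers $c_1,c_2$ such that $\phi(A)=W\,\mathrm{Diag}\big[(\det A)^{c_1},(\det A)^{c_2}\big]\,W^*$ for all $A\in\mathbb{P}_2$. -/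

import Mathlib

open scoped ComplexOrder

/-- The cone of all positive definite complex `n × n` matrices, with the subspace topology
inherited from the matrix space (the topology of any norm on it). -/
abbrev PosDefCone (n : ℕ) : Type :=
  {A : Matrix (Fin n) (Fin n) ℂ // A.PosDef}

namespace PosDefCone

/-- The product `A B A` of positive definite matrices is positive definite. -/
theorem posDef_triple {n : ℕ} (A B : PosDefCone n) : (A.1 * B.1 * A.1).PosDef := by
  have h := B.2.conjTranspose_mul_mul_same (B := A.1)
    (Matrix.mulVec_injective_of_isUnit A.2.isUnit)
  rwa [A.2.isHermitian.eq] at h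

/-- The Jordan triple product `A B A` on the cone of positive definite matrices. -/
def triple {n : ℕ} (A B : PosDefCone n) : PosDefCone n :=
  ⟨A.1 * B.1 * A.1, posDef_triple A B⟩

/-- The determinant of a positive definite matrix, as a real number. -/
noncomputable def realDet {n : ℕ} (A : PosDefCone n) : ℝ :=
  A.1.det.re

theorem ofReal_realDet {n : ℕ} (A : PosDefCone n) : ((realDet A : ℝ) : ℂ) = A.1.det := by
  have h := Complex.pos_iff.mp A.2.det_pos
  exact Complex.ext rfl (by simpa using h.2)

theorem realDet_pos {n : ℕ} (A : PosDefCone n) : 0 < realDet A :=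
  (Complex.pos_iff.mp A.2.det_pos).1

end PosDefCone

/-- A Jordan triple endomorphism of the cone of positive definite matrices:
a self-map with `φ (A B A) = φ A * φ B * φ A` for all `A`, `B`. -/
def IsJordanTripleEndomorphism {n : ℕ} (φ : PosDefCone n → PosDefCone n) : Prop :=
  ∀ A B : PosDefCone n, (φ (PosDefCone.triple A B)).1 = (φ A).1 * (φ B).1 * (φ A).1

/-!
Conjugating by the matrix logarithm turns `φ` into a map `f` of the Hermitian matrices,
`φ (exp T) = exp (f T)`. The Jordan triple identity gives `φ (A ^ k) = φ A ^ k`, so `φ` passes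
through the symmetric Trotter products `(exp (T / k) exp (S / k) exp (T / k)) ^ k`, which converge
to `exp (2 T + S)`. Hence `f` is additive, and real linear by continuity; this part works in every
dimension (`IsJordanTripleEndomorphism.exists_linearMap`).

In dimension two, write a Hermitian matrix as `a + σ v` with `a` real and `v` in Euclidean `ℝ³`,
where `σ` is the Pauli map. The positive definite matrices of determinant one form hyperbolic
three-space, and comparing the determinant and the trace in
`exp Z = exp (T / 2) exp S exp (T / 2)` gives a rule for the scalar parts and the hyperbolic law of
cosines for the vector parts (`PosDefCone.eq_add_and_cosh_eq_of_expMap_eq_triple`). Apply `f` to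
the right triangle with legs `t σ x` and `t σ y` along orthonormal `x, y`, whose hypotenuse is
`α σ x + β σ y` with `α > β`. The trace and the determinant do not change when the legs are
interchanged, whereas the hypotenuse becomes `β σ x + α σ y`. Therefore `f (σ x)` and `f (σ y)`
have the same scalar part, which must vanish (replace `y` by `-y`), and vector parts of the same
length; these are orthogonal, as one sees from `x ± y`. So `f (σ v) = σ (L v)` with `L` a multiple
`l` of an isometry, and the Pythagorean relation forces `cosh (l ρ) = cosh (l t) ^ 2` whenever
`cosh ρ = cosh t ^ 2`. Letting `t → ∞` leaves only `l = 0` and `l = 1`.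

If `l = 0`, then `f (a + σ v) = a f(1)` and diagonalizing `f 1` gives the diagonal form.
If `l = 1`, then `f 1` is scalar: as `1` commutes with every matrix, its vector part and an image
vector orthogonal to it span a right triangle that is both Euclidean and hyperbolic at every scale,
which is impossible unless a leg vanishes. An isometry of `ℝ³` is, up to sign, a rotation,
which is conjugation by a unitary (`exists_unitary_conj_pauli_of_orthonormal`), and the sign
distinguishes `A` from `A⁻¹`.
-/

open Filter Topology NormedSpace

open scoped Matrix.Norms.L2Operator MatrixOrder

/-! ### The symmetric Trotter product formula -/

theorem norm_pow_sub_pow_le {𝔸 : Type*} [NormedRing 𝔸] [NormOneClass 𝔸] {P Q : 𝔸} {m : ℝ}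
    (hm : 1 ≤ m) (hP : ‖P‖ ≤ m) (hQ : ‖Q‖ ≤ m) (n : ℕ) :
    ‖P ^ n - Q ^ n‖ ≤ n * ‖P - Q‖ * m ^ n := by
  induction n with
  | zero => simp
  | succ n ih =>
    have hmn : 1 ≤ m ^ n := one_le_pow₀ hm
    have hPn : ‖P ^ n‖ ≤ m ^ n := (norm_pow_le P n).trans (by gcongr)
    have h1 : ‖P ^ n * (P - Q)‖ ≤ m ^ n * ‖P - Q‖ :=
      (norm_mul_le _ _).trans (by gcongr)
    have h2 : ‖(P ^ n - Q ^ n) * Q‖ ≤ (n * ‖P - Q‖ * m ^ n) * m :=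
      (norm_mul_le _ _).trans (by gcongr)
    calc ‖P ^ (n + 1) - Q ^ (n + 1)‖ = ‖P ^ n * (P - Q) + (P ^ n - Q ^ n) * Q‖ := by
          rw [pow_succ, pow_succ]; congr 1; noncomm_ring
      _ ≤ m ^ n * ‖P - Q‖ + (n * ‖P - Q‖ * m ^ n) * m := norm_add_le_of_le h1 h2
      _ ≤ (m ^ n * ‖P - Q‖) * m + (n * ‖P - Q‖ * m ^ n) * m := by
          gcongr ?_ + _
          exact le_mul_of_one_le_right (by positivity) hm
      _ = _ := by push_cast; ring

theorem norm_exp_le_exp_norm {𝔸 : Type*} [NormedRing 𝔸] [NormOneClass 𝔸] [NormedAlgebra ℝ 𝔸]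
    (X : 𝔸) : ‖exp X‖ ≤ Real.exp ‖X‖ := by
  have h := exp_series_hasSum_exp' (𝕂 := ℝ) ‖X‖
  rw [← Real.exp_eq_exp_ℝ] at h
  rw [exp_eq_tsum ℝ]
  refine tsum_of_norm_bounded h fun k => ?_
  rw [norm_smul, Real.norm_of_nonneg (by positivity), smul_eq_mul]
  gcongr
  exact norm_pow_le X k

/-- The products `F h = exp (h A) exp (h B) exp (h A)` and `G h = exp (h (2 A + B))` agree to first
order at `h = 0`, so that `F (1 / n) ^ n - G (1 / n) ^ n` is `n` times a quantity `o(1 / n)`. -/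
theorem tendsto_symmetric_trotter {𝔸 : Type*} [NormedRing 𝔸] [NormOneClass 𝔸] [NormedAlgebra ℝ 𝔸]
    [CompleteSpace 𝔸] (A B : 𝔸) :
    Tendsto (fun n : ℕ => (exp ((n : ℝ)⁻¹ • A) * exp ((n : ℝ)⁻¹ • B) * exp ((n : ℝ)⁻¹ • A)) ^ n)
      atTop (𝓝 (exp ((2 : ℝ) • A + B))) := by
  let _ : NormedAlgebra ℚ 𝔸 := .restrictScalars ℚ ℝ 𝔸
  set D : 𝔸 := (2 : ℝ) • A + B with hD
  set F : ℝ → 𝔸 := fun h => exp (h • A) * exp (h • B) * exp (h • A)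
  set G : ℝ → 𝔸 := fun h => exp (h • D)
  have hexp (X : 𝔸) : HasDerivAt (fun h : ℝ => exp (h • X)) X 0 := by
    simpa using hasDerivAt_exp_smul_const (𝕂 := ℝ) X (0 : ℝ)
  have hF : HasDerivAt F D 0 := by
    have := ((hexp A).mul (hexp B)).mul (hexp A)
    refine this.congr_deriv ?_
    simp [hD, two_smul]; abel
  have hFG : HasDerivAt (fun h => F h - G h) 0 0 := (hF.sub (hexp D)).congr_deriv (sub_self D)
  have hslope : Tendsto (fun n : ℕ => (n : ℝ) • (F (n : ℝ)⁻¹ - G (n : ℝ)⁻¹)) atTop (𝓝 0) := by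
    have h1 := hFG.tendsto_slope_zero
    have h2 : Tendsto (fun n : ℕ => (n : ℝ)⁻¹) atTop (𝓝[≠] (0 : ℝ)) :=
      (tendsto_inv_atTop_nhdsGT_zero.comp tendsto_natCast_atTop_atTop).mono_right
        (nhdsWithin_mono _ fun x hx => ne_of_gt hx)
    have h3 := h1.comp h2
    refine h3.congr fun n => ?_
    simp [F, G]
  set c : ℝ := 2 * ‖A‖ + ‖B‖
  have hle (h : ℝ) (hh : 0 ≤ h) (X : 𝔸) : ‖exp (h • X)‖ ≤ Real.exp (h * ‖X‖) := by
    refine (norm_exp_le_exp_norm _).trans ?_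
    rw [norm_smul, Real.norm_of_nonneg hh]
  have hFc (h : ℝ) (hh : 0 ≤ h) : ‖F h‖ ≤ Real.exp (h * c) := by
    calc ‖F h‖ ≤ Real.exp (h * ‖A‖) * Real.exp (h * ‖B‖) * Real.exp (h * ‖A‖) := by
          refine (norm_mul_le _ _).trans ?_
          gcongr
          · refine (norm_mul_le _ _).trans ?_
            gcongr <;> exact hle h hh _
          · exact hle h hh _
      _ = _ := by rw [← Real.exp_add, ← Real.exp_add]; congr 1; simp only [c]; ring
  have hGc (h : ℝ) (hh : 0 ≤ h) : ‖G h‖ ≤ Real.exp (h * c) := by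
    refine (hle h hh D).trans ?_
    gcongr
    refine (norm_add_le _ _).trans ?_
    simp [c, norm_smul]
  have hG : ∀ᶠ n : ℕ in atTop, G (n : ℝ)⁻¹ ^ n = exp D := by
    filter_upwards [eventually_ne_atTop 0] with n hn
    have : (n : ℝ) ≠ 0 := by exact_mod_cast hn
    simp only [G]
    rw [← exp_nsmul, ← Nat.cast_smul_eq_nsmul ℝ, smul_smul, mul_inv_cancel₀ this, one_smul]
  have hdiff : Tendsto (fun n : ℕ => F (n : ℝ)⁻¹ ^ n - G (n : ℝ)⁻¹ ^ n) atTop (𝓝 0) := by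
    rw [tendsto_zero_iff_norm_tendsto_zero] at hslope ⊢
    have hb := hslope.mul_const (Real.exp c)
    rw [zero_mul] at hb
    refine squeeze_zero' (.of_forall fun n => norm_nonneg _) ?_ hb
    filter_upwards [eventually_ne_atTop 0] with n hn
    have hn' : (n : ℝ) ≠ 0 := by exact_mod_cast hn
    have hn0 : (0 : ℝ) ≤ (n : ℝ)⁻¹ := by positivity
    have hm : 1 ≤ Real.exp ((n : ℝ)⁻¹ * c) := Real.one_le_exp (by positivity)
    refine (norm_pow_sub_pow_le hm (hFc _ hn0) (hGc _ hn0) n).trans (le_of_eq ?_)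
    rw [← Real.exp_nat_mul, ← mul_assoc, mul_inv_cancel₀ hn', one_mul, norm_smul]
    simp
  have := hdiff.add (tendsto_const_nhds (x := exp D))
  rw [zero_add] at this
  refine this.congr' ?_
  filter_upwards [hG] with n hn
  rw [hn, sub_add_cancel]

/-! ### Exponential coordinates on the cone -/

namespace PosDefCone

variable {n : ℕ}

theorem isStrictlyPositive (A : PosDefCone n) : IsStrictlyPositive A.1 :=
  Matrix.isStrictlyPositive_iff_posDef.mpr A.2

/-- The exponential of a Hermitian matrix, as a point of the positive definite cone. -/
noncomputable def expMap (T : selfAdjoint (Matrix (Fin n) (Fin n) ℂ)) : PosDefCone n :=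
  ⟨exp T.1, by
    rw [← Matrix.isStrictlyPositive_iff_posDef]
    exact (Matrix.isUnit_exp T.1).isStrictlyPositive T.2.exp_nonneg⟩

/-- The logarithm of a positive definite matrix, as a Hermitian matrix. It is the two-sided inverse
of `expMap`. -/
noncomputable def logMap (A : PosDefCone n) : selfAdjoint (Matrix (Fin n) (Fin n) ℂ) :=
  ⟨CFC.log A.1, IsSelfAdjoint.log⟩

theorem coe_expMap (T : selfAdjoint (Matrix (Fin n) (Fin n) ℂ)) : (expMap T).1 = exp T.1 := rfl

@[simp]
theorem expMap_logMap (A : PosDefCone n) : expMap (logMap A) = A :=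
  Subtype.ext (CFC.exp_log A.1 A.isStrictlyPositive)

@[simp]
theorem logMap_expMap (T : selfAdjoint (Matrix (Fin n) (Fin n) ℂ)) : logMap (expMap T) = T :=
  Subtype.ext (CFC.log_exp T.1 T.2)

theorem expMap_injective :
    Function.Injective (expMap : selfAdjoint (Matrix (Fin n) (Fin n) ℂ) → PosDefCone n) :=
  Function.LeftInverse.injective logMap_expMap

theorem continuous_expMap :
    Continuous (expMap : selfAdjoint (Matrix (Fin n) (Fin n) ℂ) → PosDefCone n) := by
  let _ : NormedAlgebra ℚ (Matrix (Fin n) (Fin n) ℂ) := .restrictScalars ℚ ℝ _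
  exact (exp_continuous.comp continuous_subtype_val).subtype_mk _

theorem continuous_logMap :
    Continuous (logMap : PosDefCone n → selfAdjoint (Matrix (Fin n) (Fin n) ℂ)) :=
  (CFC.continuousOn_log.comp_continuous continuous_subtype_val
    fun A => ⟨A.2.isHermitian, A.2.isUnit⟩).subtype_mk _

/-- The natural powers of a positive definite matrix, within the cone. -/
noncomputable def pow (A : PosDefCone n) (k : ℕ) : PosDefCone n :=
  ⟨A.1 ^ k, by
    induction k using Nat.twoStepInduction with
    | zero => simpa using Matrix.PosDef.one
    | one => simpa using A.2
    | more k ih _ =>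
      have : A.1 ^ (k + 2) = A.1 * A.1 ^ k * A.1 := by rw [← pow_succ', ← pow_succ]
      rw [this]
      exact posDef_triple A ⟨_, ih⟩⟩

theorem coe_pow (A : PosDefCone n) (k : ℕ) : (A.pow k).1 = A.1 ^ k := rfl

theorem pow_add_two (A : PosDefCone n) (k : ℕ) : A.pow (k + 2) = triple A (A.pow k) :=
  Subtype.ext <| by simp only [coe_pow, triple]; rw [← pow_succ', ← pow_succ]

theorem pow_one (A : PosDefCone n) : A.pow 1 = A := Subtype.ext (_root_.pow_one A.1)

theorem expMap_nsmul (T : selfAdjoint (Matrix (Fin n) (Fin n) ℂ)) (k : ℕ) :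
    expMap (k • T) = (expMap T).pow k :=
  Subtype.ext (by simpa [coe_expMap, coe_pow] using Matrix.exp_nsmul k T.1)

theorem pow_left_injective {k : ℕ} (hk : k ≠ 0) :
    Function.Injective (fun A : PosDefCone n => A.pow k) := by
  intro A B h
  rw [← expMap_logMap A, ← expMap_logMap B] at h ⊢
  simp only [← expMap_nsmul] at h
  have := expMap_injective h
  rw [← Nat.cast_smul_eq_nsmul ℝ, ← Nat.cast_smul_eq_nsmul ℝ] at this
  rw [smul_right_injective _ (Nat.cast_ne_zero.mpr hk) this]

end PosDefCone

/-! ### Linearization of a continuous Jordan triple endomorphism -/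

namespace IsJordanTripleEndomorphism

open PosDefCone

variable {n : ℕ} {φ : PosDefCone n → PosDefCone n}

theorem map_triple (hφ : IsJordanTripleEndomorphism φ) (A B : PosDefCone n) :
    φ (triple A B) = triple (φ A) (φ B) := Subtype.ext (hφ A B)

theorem map_pow (hφ : IsJordanTripleEndomorphism φ) (A : PosDefCone n) (k : ℕ) :
    φ (A.pow k) = (φ A).pow k := by
  induction k using Nat.twoStepInduction with
  | zero =>
    -- `X = φ 1` satisfies `X * X * X = X`, hence `X ^ 2 = 1`, and square roots are unique.
    have hone : ∀ B : PosDefCone n, triple (A.pow 0) B = B := fun B =>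
      Subtype.ext (by simp [triple, coe_pow])
    apply pow_left_injective two_ne_zero
    have h := hφ.map_triple (A.pow 0) (A.pow 0)
    rw [hone] at h
    have h' := congrArg Subtype.val h
    apply Subtype.ext
    simp only [triple, coe_pow, _root_.pow_zero, one_pow] at h' ⊢
    exact (φ (A.pow 0)).2.isUnit.mul_right_cancel
      (by rw [one_mul, _root_.pow_two]; exact h'.symm)
  | one => rw [pow_one, pow_one]
  | more k ih _ => rw [pow_add_two, hφ.map_triple, ih, ← pow_add_two]

theorem logMap_conj_nsmul (hφ : IsJordanTripleEndomorphism φ)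
    (T : selfAdjoint (Matrix (Fin n) (Fin n) ℂ)) (k : ℕ) :
    logMap (φ (expMap (k • T))) = k • logMap (φ (expMap T)) := by
  apply expMap_injective
  rw [expMap_logMap, expMap_nsmul, hφ.map_pow, expMap_nsmul, expMap_logMap]

/-- Additivity of `T ↦ log (φ (exp T))`: the map `φ` carries the symmetric Trotter products of `T`
and `S` to those of the images, because `T ↦ log (φ (exp T))` commutes with division by a positive
integer. -/
theorem logMap_conj_add [NeZero n] (hφ : IsJordanTripleEndomorphism φ) (hcont : Continuous φ)
    (T S : selfAdjoint (Matrix (Fin n) (Fin n) ℂ)) :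
    logMap (φ (expMap (T + S))) = logMap (φ (expMap T)) + logMap (φ (expMap S)) := by
  set f := fun T => logMap (φ (expMap T)) with hf
  have hnat (T) (k : ℕ) : f (k • T) = k • f T := hφ.logMap_conj_nsmul T k
  have hφf (T) : φ (expMap T) = expMap (f T) := (expMap_logMap _).symm
  have hinv (T) (k : ℕ) (hk : k ≠ 0) : f ((k : ℝ)⁻¹ • T) = (k : ℝ)⁻¹ • f T := by
    have hk' : (k : ℝ) ≠ 0 := by exact_mod_cast hk
    rw [eq_inv_smul_iff₀ hk', Nat.cast_smul_eq_nsmul, ← hnat, ← Nat.cast_smul_eq_nsmul ℝ,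
      smul_inv_smul₀ hk']
  have key (T S) : f ((2 : ℝ) • T + S) = (2 : ℝ) • f T + f S := by
    have trot (T S : selfAdjoint (Matrix (Fin n) (Fin n) ℂ)) :
        Tendsto (fun k : ℕ => (triple (expMap ((k : ℝ)⁻¹ • T)) (expMap ((k : ℝ)⁻¹ • S))).pow k)
          atTop (𝓝 (expMap ((2 : ℝ) • T + S))) :=
      tendsto_subtype_rng.mpr (tendsto_symmetric_trotter T.1 S.1)
    apply expMap_injective
    rw [← hφf]
    refine tendsto_nhds_unique ((hcont.tendsto _).comp (trot T S)) ?_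
    refine (trot (f T) (f S)).congr' ?_
    filter_upwards [eventually_ne_atTop 0] with k hk
    simp only [Function.comp]
    rw [hφ.map_pow, hφ.map_triple, hφf, hφf, hinv _ _ hk, hinv _ _ hk]
  have h2 := key ((2 : ℝ)⁻¹ • T) S
  have h3 := hinv T 2 two_ne_zero
  push_cast at h3
  rwa [smul_inv_smul₀ two_ne_zero, h3, smul_inv_smul₀ two_ne_zero] at h2

/-- In exponential coordinates a continuous Jordan triple endomorphism is real linear. -/
theorem exists_linearMap [NeZero n] (hφ : IsJordanTripleEndomorphism φ) (hcont : Continuous φ) :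
    ∃ f : selfAdjoint (Matrix (Fin n) (Fin n) ℂ) →ₗ[ℝ] selfAdjoint (Matrix (Fin n) (Fin n) ℂ),
      ∀ T, φ (expMap T) = expMap (f T) := by
  let f : selfAdjoint (Matrix (Fin n) (Fin n) ℂ) →+ selfAdjoint (Matrix (Fin n) (Fin n) ℂ) :=
    AddMonoidHom.mk' (fun T => logMap (φ (expMap T))) (hφ.logMap_conj_add hcont)
  have hfc : Continuous f := continuous_logMap.comp (hcont.comp continuous_expMap)
  exact ⟨(f.toRealLinearMap hfc).toLinearMap, fun T => (expMap_logMap _).symm⟩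

end IsJordanTripleEndomorphism

/-! ### Hermitian two-by-two matrices in Pauli coordinates -/

theorem exp_smul_of_mul_self_eq_one {𝔸 : Type*} [NormedRing 𝔸] [NormedAlgebra ℝ 𝔸]
    [CompleteSpace 𝔸] {J : 𝔸} (hJ : J * J = 1) (p : ℝ) :
    exp (p • J) = Real.cosh p • (1 : 𝔸) + Real.sinh p • J := by
  have hs := exp_series_hasSum_exp' (𝕂 := ℝ) (p • J)
  refine hs.unique ?_
  have hJ2 (k : ℕ) : J ^ (2 * k) = 1 := by rw [pow_mul, pow_two, hJ, one_pow]
  refine HasSum.even_add_odd ?_ ?_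
  · convert (Real.hasSum_cosh p).smul_const (1 : 𝔸) using 2 with k
    rw [smul_pow, hJ2, smul_smul]
    congr 1
    ring
  · convert (Real.hasSum_sinh p).smul_const J using 2 with k
    rw [smul_pow, pow_succ J, hJ2, one_mul, smul_smul]
    congr 1
    ring

/-- The matrix `v₀ σ₁ + v₁ σ₂ + v₂ σ₃`, where `σ₁, σ₂, σ₃` are the Pauli matrices. -/
noncomputable def pauli :
    EuclideanSpace ℝ (Fin 3) →ₗ[ℝ] selfAdjoint (Matrix (Fin 2) (Fin 2) ℂ) where
  toFun v := ⟨!![(v 2 : ℂ), v 0 - v 1 * Complex.I; v 0 + v 1 * Complex.I, -v 2], by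
    rw [selfAdjoint.mem_iff, Matrix.star_eq_conjTranspose]
    ext i j
    fin_cases i <;> fin_cases j <;> simp [sub_eq_add_neg]⟩
  map_add' v w := by
    ext i j
    fin_cases i <;> fin_cases j <;> simp <;> ring
  map_smul' a v := by
    ext i j
    fin_cases i <;> fin_cases j <;> simp <;> ring

theorem coe_pauli (v : EuclideanSpace ℝ (Fin 3)) :
    (pauli v).1 = !![(v 2 : ℂ), v 0 - v 1 * Complex.I; v 0 + v 1 * Complex.I, -v 2] := rfl

theorem exists_eq_smul_one_add_pauli (T : selfAdjoint (Matrix (Fin 2) (Fin 2) ℂ)) :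
    ∃ (a : ℝ) (v : EuclideanSpace ℝ (Fin 3)), T = a • 1 + pauli v := by
  refine ⟨((T.1 0 0).re + (T.1 1 1).re) / 2,
    !₂[(T.1 1 0).re, (T.1 1 0).im, ((T.1 0 0).re - (T.1 1 1).re) / 2], ?_⟩
  have h := T.2
  rw [selfAdjoint.mem_iff, Matrix.star_eq_conjTranspose] at h
  have h00 := congrFun (congrFun h 0) 0
  have h01 := congrFun (congrFun h 0) 1
  have h11 := congrFun (congrFun h 1) 1
  simp only [Matrix.conjTranspose_apply, RCLike.star_def, Complex.ext_iff, Complex.conj_re,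
    Complex.conj_im] at h00 h01 h11
  ext i j
  fin_cases i <;> fin_cases j <;> apply Complex.ext <;>
    simp [coe_pauli, -Complex.coe_smul] <;> linarith

theorem norm_sq_eq_coords (v : EuclideanSpace ℝ (Fin 3)) :
    ‖v‖ ^ 2 = v 0 ^ 2 + v 1 ^ 2 + v 2 ^ 2 := by
  rw [EuclideanSpace.real_norm_sq_eq, Fin.sum_univ_three]

theorem inner_eq_coords (v w : EuclideanSpace ℝ (Fin 3)) :
    inner ℝ v w = v 0 * w 0 + v 1 * w 1 + v 2 * w 2 := by
  rw [PiLp.inner_apply, Fin.sum_univ_three]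
  simp [mul_comm]

theorem pauli_mul_add_pauli_mul (v w : EuclideanSpace ℝ (Fin 3)) :
    (pauli v).1 * (pauli w).1 + (pauli w).1 * (pauli v).1 = (2 * inner ℝ v w : ℝ) • 1 := by
  rw [inner_eq_coords]
  ext i j
  fin_cases i <;> fin_cases j <;> apply Complex.ext <;>
    simp [coe_pauli] <;> ring

theorem pauli_mul_self (v : EuclideanSpace ℝ (Fin 3)) :
    (pauli v).1 * (pauli v).1 = (‖v‖ ^ 2) • 1 := by
  have h := pauli_mul_add_pauli_mul v v
  rw [← two_smul ℝ, real_inner_self_eq_norm_sq, mul_smul] at h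
  exact smul_right_injective _ (two_ne_zero' ℝ) h

/-- The function `sinh p / p` of the norm `p` of `v` (with the value `0` at `v = 0`, where
it is only ever multiplied by a quantity vanishing there). -/
noncomputable def sinhc (v : EuclideanSpace ℝ (Fin 3)) : ℝ := Real.sinh ‖v‖ / ‖v‖

theorem exp_pauli (v : EuclideanSpace ℝ (Fin 3)) :
    exp (pauli v).1 = Real.cosh ‖v‖ • (1 : Matrix (Fin 2) (Fin 2) ℂ) + sinhc v • (pauli v).1 := by
  rcases eq_or_ne v 0 with rfl | hv
  · simp [exp_zero]
  have hv' : ‖v‖ ≠ 0 := norm_ne_zero_iff.mpr hv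
  have hJ : (‖v‖⁻¹ • (pauli v).1) * (‖v‖⁻¹ • (pauli v).1) = 1 := by
    rw [smul_mul_smul_comm, pauli_mul_self, smul_smul]
    field_simp
    simp
  have := exp_smul_of_mul_self_eq_one hJ ‖v‖
  rw [smul_inv_smul₀ hv'] at this
  rw [this, smul_smul, sinhc, div_eq_mul_inv]

theorem exp_smul_one_add {n : ℕ} (a : ℝ) (X : Matrix (Fin n) (Fin n) ℂ) :
    exp (a • (1 : Matrix (Fin n) (Fin n) ℂ) + X) = Real.exp a • exp X := by
  rw [Matrix.exp_add_of_commute _ _ ((Commute.one_left X).smul_left a)]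
  have : exp (a • (1 : Matrix (Fin n) (Fin n) ℂ)) = Real.exp a • 1 := by
    have h := algebraMap_exp_comm (𝕂 := ℝ) (𝔸 := Matrix (Fin n) (Fin n) ℂ) a
    rw [← Real.exp_eq_exp_ℝ, Algebra.algebraMap_eq_smul_one, Algebra.algebraMap_eq_smul_one] at h
    exact h.symm
  rw [this, smul_one_mul]

theorem trace_pauli (v : EuclideanSpace ℝ (Fin 3)) : (pauli v).1.trace = 0 := by
  simp [coe_pauli, Matrix.trace_fin_two]

theorem trace_pauli_mul (v w : EuclideanSpace ℝ (Fin 3)) :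
    ((pauli v).1 * (pauli w).1).trace = (2 * inner ℝ v w : ℝ) := by
  rw [inner_eq_coords]
  apply Complex.ext <;>
    simp [coe_pauli, Matrix.trace_fin_two] <;> ring

theorem det_exp_pauli (v : EuclideanSpace ℝ (Fin 3)) : (exp (pauli v).1).det = 1 := by
  have h1 : (exp (pauli v).1).det
      = ((Real.cosh ‖v‖ ^ 2 - sinhc v ^ 2 * ‖v‖ ^ 2 : ℝ) : ℂ) := by
    rw [exp_pauli, norm_sq_eq_coords]
    apply Complex.ext <;> simp [coe_pauli, Matrix.det_fin_two, pow_two] <;> ring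
  rw [h1, ← mul_pow]
  have h2 : sinhc v * ‖v‖ = Real.sinh ‖v‖ := by
    rcases eq_or_ne v 0 with rfl | hv
    · simp
    · rw [sinhc, div_mul_cancel₀ _ (norm_ne_zero_iff.mpr hv)]
  rw [h2, Real.cosh_sq_sub_sinh_sq, Complex.ofReal_one]

theorem trace_exp_pauli (v : EuclideanSpace ℝ (Fin 3)) :
    (exp (pauli v).1).trace = (2 * Real.cosh ‖v‖ : ℝ) := by
  rw [exp_pauli, Matrix.trace_add, Matrix.trace_smul, Matrix.trace_smul, trace_pauli]
  simp [mul_comm]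

theorem exp_half_smul_mul_self {n : ℕ} (X : Matrix (Fin n) (Fin n) ℂ) :
    exp ((2 : ℝ)⁻¹ • X) * exp ((2 : ℝ)⁻¹ • X) = exp X := by
  rw [← Matrix.exp_add_of_commute _ _ (Commute.refl _), ← add_smul]
  norm_num

namespace PosDefCone

theorem coe_expMap_smul_one_add_pauli (a : ℝ) (v : EuclideanSpace ℝ (Fin 3)) :
    (expMap (a • 1 + pauli v)).1 = Real.exp a • exp (pauli v).1 :=
  exp_smul_one_add a (pauli v).1

theorem det_expMap (a : ℝ) (v : EuclideanSpace ℝ (Fin 3)) :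
    (expMap (a • 1 + pauli v)).1.det = (Real.exp (2 * a) : ℝ) := by
  rw [coe_expMap_smul_one_add_pauli, Matrix.det_smul_of_tower, det_exp_pauli, two_mul, Real.exp_add]
  simp [pow_two]

/-- The hyperbolic law of cosines. The first conclusion compares determinants, the second traces;
`z` is the third side of the triangle with sides `v` and `w`. -/
theorem eq_add_and_cosh_eq_of_expMap_eq_triple {a b c : ℝ} {v w z : EuclideanSpace ℝ (Fin 3)}
    (h : expMap (c • 1 + pauli z) =
      triple (expMap ((2 : ℝ)⁻¹ • (a • 1 + pauli v))) (expMap (b • 1 + pauli w))) :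
    c = a + b ∧ Real.cosh ‖z‖ =
      Real.cosh ‖v‖ * Real.cosh ‖w‖ + sinhc v * sinhc w * inner ℝ v w := by
  have hhalf : (expMap ((2 : ℝ)⁻¹ • (a • 1 + pauli v))).1 *
      (expMap ((2 : ℝ)⁻¹ • (a • 1 + pauli v))).1 = (expMap (a • 1 + pauli v)).1 :=
    exp_half_smul_mul_self (a • 1 + pauli v : selfAdjoint _).1
  have h' := congrArg Subtype.val h
  simp only [triple] at h'
  have hc : c = a + b := by
    have hd := congrArg Matrix.det h'
    rw [Matrix.det_mul, Matrix.det_mul, mul_right_comm, ← Matrix.det_mul, hhalf, det_expMap,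
      det_expMap, det_expMap, ← Complex.ofReal_mul, ← Real.exp_add, Complex.ofReal_inj,
      Real.exp_eq_exp] at hd
    linarith
  refine ⟨hc, ?_⟩
  have ht := congrArg Matrix.trace h'
  rw [Matrix.trace_mul_cycle, hhalf, coe_expMap_smul_one_add_pauli, coe_expMap_smul_one_add_pauli,
    coe_expMap_smul_one_add_pauli, smul_mul_smul_comm, ← Real.exp_add, ← hc, Matrix.trace_smul,
    Matrix.trace_smul] at ht
  have ht' := smul_right_injective ℂ (Real.exp_ne_zero c) ht
  rw [trace_exp_pauli, exp_pauli v, exp_pauli w] at ht'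
  simp only [add_mul, mul_add, Matrix.trace_add, smul_mul_smul_comm, one_mul, mul_one,
    Matrix.trace_smul, trace_pauli, trace_pauli_mul, Matrix.trace_one] at ht'
  have := congrArg Complex.re ht'
  simp at this
  linarith

/-- The isosceles right triangle with legs of length `t`: its hypotenuse has length `ρ` with
`cosh ρ = cosh t ^ 2`, and its direction `α x + β y` is not symmetric in the two legs. The
coefficients are `α = ρ c / q` and `β = ρ / q` with `c = cosh t` and `q = √(c ^ 2 + 1)`. -/
theorem exists_triple_expMap_pauli_eq {t : ℝ} (ht : 0 < t) :
    ∃ α β ρ : ℝ, 0 < β ∧ β < α ∧ 0 < ρ ∧ α ^ 2 + β ^ 2 = ρ ^ 2 ∧ Real.cosh ρ = Real.cosh t ^ 2 ∧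
      ∀ x y : EuclideanSpace ℝ (Fin 3), ‖x‖ = 1 → ‖y‖ = 1 → inner ℝ x y = 0 →
        expMap (pauli (α • x + β • y)) =
          triple (expMap ((2 : ℝ)⁻¹ • pauli (t • x))) (expMap (pauli (t • y))) := by
  set c := Real.cosh t
  set s := Real.sinh t
  have hcs : c ^ 2 - s ^ 2 = 1 := Real.cosh_sq_sub_sinh_sq t
  have hs : 0 < s := Real.sinh_pos_iff.mpr ht
  have hc : 1 < c := Real.one_lt_cosh.mpr ht.ne'
  set q := √(c ^ 2 + 1)
  have hq : 0 < q := by positivity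
  have hq2 : q ^ 2 = c ^ 2 + 1 := Real.sq_sqrt (by positivity)
  set ρ := Real.arsinh (s * q)
  have hρ : 0 < ρ := Real.arsinh_pos_iff.mpr (by positivity)
  have hsρ : Real.sinh ρ = s * q := Real.sinh_arsinh _
  have hcρ : Real.cosh ρ = c ^ 2 := by
    have : Real.cosh ρ ^ 2 = (c ^ 2) ^ 2 := by
      rw [Real.cosh_sq, hsρ, mul_pow, hq2, show s ^ 2 = c ^ 2 - 1 by linarith]; ring
    exact (pow_left_inj₀ (Real.cosh_pos _).le (by positivity) two_ne_zero).mp this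
  have hsq : (ρ * c / q) ^ 2 + (ρ / q) ^ 2 = ρ ^ 2 := by
    field_simp
    rw [hq2]
  refine ⟨ρ * c / q, ρ / q, ρ, by positivity, ?_, hρ, hsq, hcρ, ?_⟩
  · gcongr
    exact lt_mul_of_one_lt_right hρ hc
  intro x y hx hy hxy
  have hz : ‖(ρ * c / q) • x + (ρ / q) • y‖ = ρ := by
    refine (pow_left_inj₀ (norm_nonneg _) hρ.le two_ne_zero).mp ?_
    rw [norm_add_sq_real, norm_smul, norm_smul, inner_smul_left, inner_smul_right, hx, hy, hxy,
      mul_one, mul_one, Real.norm_eq_abs, Real.norm_eq_abs, sq_abs, sq_abs]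
    linarith
  have hx2 : (pauli x).1 * (pauli x).1 = 1 := by rw [pauli_mul_self, hx]; simp
  have hy2 : (pauli y).1 * (pauli y).1 = 1 := by rw [pauli_mul_self, hy]; simp
  have hanti : (pauli y).1 * (pauli x).1 = - ((pauli x).1 * (pauli y).1) := by
    have := pauli_mul_add_pauli_mul x y
    rw [hxy, mul_zero, zero_smul] at this
    exact (neg_eq_of_add_eq_zero_right this).symm
  have hex (p : ℝ) := exp_smul_of_mul_self_eq_one hx2 p
  have hey (p : ℝ) := exp_smul_of_mul_self_eq_one hy2 p
  apply Subtype.ext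
  simp only [triple, coe_expMap]
  rw [exp_pauli, sinhc, hz, hsρ, hcρ]
  simp only [map_add, map_smul, AddSubgroup.coe_add, selfAdjoint.val_smul, smul_smul]
  rw [hex, hey]
  have hch : Real.cosh (2⁻¹ * t) ^ 2 + Real.sinh (2⁻¹ * t) ^ 2 = c := by
    rw [← Real.cosh_two_mul]; congr 1; ring
  have hsh : 2 * Real.sinh (2⁻¹ * t) * Real.cosh (2⁻¹ * t) = s := by
    rw [← Real.sinh_two_mul]; congr 1; ring
  have h1 : Real.cosh (2⁻¹ * t) ^ 2 - Real.sinh (2⁻¹ * t) ^ 2 = 1 := Real.cosh_sq_sub_sinh_sq _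
  set X := (pauli x).1
  set Y := (pauli y).1
  set C := Real.cosh (2⁻¹ * t)
  set S := Real.sinh (2⁻¹ * t)
  have hXYX : X * Y * X = -Y := by rw [mul_assoc, hanti, mul_neg, ← mul_assoc, hx2, one_mul]
  have hprod : (C • 1 + S • X) * (c • 1 + s • Y) * (C • 1 + S • X) =
      (c * (C ^ 2 + S ^ 2)) • 1 + (c * (2 * S * C)) • X + (s * (C ^ 2 - S ^ 2)) • Y := by
    simp only [add_mul, mul_add, smul_mul_smul_comm, one_mul, mul_one, hx2, hXYX, hanti]
    module
  rw [hprod, hch, hsh, h1]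
  have e1 : s * q / ρ * (ρ * c / q) = c * s := by field_simp
  have e2 : s * q / ρ * (ρ / q) = s := by field_simp
  rw [smul_add, smul_smul, smul_smul, e1, e2, mul_one, pow_two, add_assoc]

end PosDefCone

/-! ### Two functional equations for the hyperbolic cosine -/

theorem Real.log_two_mul_cosh (x : ℝ) :
    Real.log (2 * Real.cosh x) = x + Real.log (1 + Real.exp (-2 * x)) := by
  have h : 2 * Real.cosh x = Real.exp x * (1 + Real.exp (-2 * x)) := by
    rw [mul_add, ← Real.exp_add, Real.cosh_eq, mul_one]
    ring_nf
  rw [h, Real.log_mul (Real.exp_pos x).ne' (by positivity), Real.log_exp]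

/-- Scaling by `l` preserves the relation `cosh ρ = cosh t ^ 2` only for `l = 0` and `l = 1`: since
`log (2 cosh x) = x + o(1)`, the relation reads `ρ = 2 t - log 2 + o(1)` as `t → ∞`. -/
theorem eq_zero_or_eq_one_of_cosh_eq_sq {l : ℝ} (hl : 0 ≤ l)
    (h : ∀ t : ℝ, 0 < t → ∃ ρ : ℝ, 0 < ρ ∧ Real.cosh ρ = Real.cosh t ^ 2 ∧
      Real.cosh (l * ρ) = Real.cosh (l * t) ^ 2) : l = 0 ∨ l = 1 := by
  rcases hl.eq_or_lt with rfl | hl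
  · exact .inl rfl
  right
  have h' : ∀ t : ℝ, ∃ ρ : ℝ, 0 < t → 0 < ρ ∧ Real.cosh ρ = Real.cosh t ^ 2 ∧
      Real.cosh (l * ρ) = Real.cosh (l * t) ^ 2 := fun t => by
    by_cases ht : 0 < t
    · obtain ⟨ρ, hρ⟩ := h t ht
      exact ⟨ρ, fun _ => hρ⟩
    · exact ⟨0, fun h => absurd h ht⟩
  choose ρ hρ using h'
  set u : ℝ → ℝ := fun x => Real.log (1 + Real.exp (-2 * x))
  have hu : Tendsto u atTop (𝓝 0) := by
    have h1 : Tendsto (fun x : ℝ => 1 + Real.exp (-2 * x)) atTop (𝓝 1) := by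
      have h2 : Tendsto (fun x : ℝ => -2 * x) atTop atBot :=
        tendsto_id.const_mul_atTop_of_neg (by norm_num)
      simpa using (Real.tendsto_exp_atBot.comp h2).const_add 1
    simpa only [Real.log_one] using h1.log one_ne_zero
  have hρt : Tendsto ρ atTop atTop := by
    refine tendsto_atTop_mono' _ ?_ tendsto_id
    filter_upwards [eventually_gt_atTop 0] with t ht
    obtain ⟨h0, h1, -⟩ := hρ t ht
    have h2 : |t| ≤ |ρ t| := by
      rw [← Real.cosh_le_cosh, h1]
      nlinarith [Real.one_le_cosh t]
    rwa [abs_of_pos ht, abs_of_pos h0] at h2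
  have hlim : Tendsto (fun t => 2 * u (l * t) - u (l * ρ t) - 2 * l * u t + l * u (ρ t))
      atTop (𝓝 0) := by
    have hlt : Tendsto (fun t : ℝ => l * t) atTop atTop := tendsto_id.const_mul_atTop hl
    have := ((((hu.comp hlt).const_mul 2).sub (hu.comp (hlt.comp hρt))).sub
      (hu.const_mul (2 * l))).add ((hu.comp hρt).const_mul l)
    simpa using this
  have heq : ∀ᶠ t in atTop, 2 * u (l * t) - u (l * ρ t) - 2 * l * u t + l * u (ρ t)
      = (1 - l) * Real.log 2 := by
    filter_upwards [eventually_gt_atTop 0] with t ht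
    obtain ⟨-, h1, h2⟩ := hρ t ht
    have aux {x y : ℝ} (hxy : Real.cosh y = Real.cosh x ^ 2) :
        y + u y + Real.log 2 = 2 * (x + u x) := by
      have hx := Real.cosh_pos x
      rw [← Real.log_two_mul_cosh, ← Real.log_two_mul_cosh, hxy,
        ← Real.log_mul (by positivity) two_ne_zero]
      rw [show 2 * Real.cosh x ^ 2 * 2 = (2 * Real.cosh x) ^ 2 by ring, Real.log_pow]
      norm_num
    have e1 := aux h1
    have e2 := aux h2
    linear_combination l * e1 - e2
  have h0 := tendsto_nhds_unique (tendsto_const_nhds.congr' (heq.mono fun _ h => h.symm)) hlim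
  have := (mul_eq_zero.mp h0).resolve_right (Real.log_pos one_lt_two).ne'
  linarith

/-- A right triangle obeying both the Euclidean and the hyperbolic theorem of Pythagoras at every
scale is degenerate: otherwise `r < p + q`, and `cosh (s p) cosh (s q)`, which is at least
`exp (s (p + q)) / 4`, outgrows `cosh (s r)`. -/
theorem eq_zero_or_eq_zero_of_cosh_mul {p q r : ℝ} (hp : 0 ≤ p) (hq : 0 ≤ q)
    (hr : r ^ 2 = p ^ 2 + q ^ 2)
    (h : ∀ s : ℝ, 0 < s → Real.cosh (s * r) = Real.cosh (s * p) * Real.cosh (s * q)) :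
    p = 0 ∨ q = 0 := by
  by_contra! hpq
  have hp : 0 < p := hp.lt_of_ne' hpq.1
  have hq : 0 < q := hq.lt_of_ne' hpq.2
  have hlt : |r| < p + q := abs_lt_of_sq_lt_sq (by nlinarith [mul_pos hp hq]) (by positivity)
  have hd : 0 < p + q - |r| := sub_pos.mpr hlt
  -- At this scale `s * (p + q) = s * |r| + log 4 + 1`.
  set s := (Real.log 4 + 1) / (p + q - |r|)
  have hs : 0 < s := div_pos (by have := Real.log_pos (x := 4) (by norm_num); linarith) hd
  have hlow (x : ℝ) : Real.exp x ≤ 2 * Real.cosh x := by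
    rw [Real.cosh_eq]; linarith [Real.exp_pos (-x)]
  have hup : Real.cosh (s * r) ≤ Real.exp (s * |r|) := by
    rw [← Real.cosh_abs, abs_mul, abs_of_pos hs]
    rw [Real.cosh_eq]
    have : Real.exp (-(s * |r|)) ≤ Real.exp (s * |r|) :=
      Real.exp_le_exp.mpr (neg_le_self (by positivity))
    linarith
  have h4 : Real.exp (s * p + s * q) ≤ Real.exp (Real.log 4 + s * |r|) := by
    rw [Real.exp_add, Real.exp_add, Real.exp_log (by norm_num)]
    calc _ ≤ (2 * Real.cosh (s * p)) * (2 * Real.cosh (s * q)) :=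
          mul_le_mul (hlow _) (hlow _) (Real.exp_pos _).le (by positivity)
      _ = 4 * Real.cosh (s * r) := by rw [h s hs]; ring
      _ ≤ _ := by gcongr
  have h5 := Real.exp_le_exp.mp h4
  have h6 : s * (p + q - |r|) = Real.log 4 + 1 := div_mul_cancel₀ _ hd.ne'
  linarith

/-! ### Linear maps preserving the exponential triple relation -/

open PosDefCone

section

variable {f : selfAdjoint (Matrix (Fin 2) (Fin 2) ℂ) →ₗ[ℝ] selfAdjoint (Matrix (Fin 2) (Fin 2) ℂ)}

/-- The linear map `f` preserves the relation `exp Z = exp (T / 2) exp S exp (T / 2)`, that is,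
`exp T ↦ exp (f T)` respects the Jordan triple product. -/
def PreservesExpTriple
    (f : selfAdjoint (Matrix (Fin 2) (Fin 2) ℂ) →ₗ[ℝ] selfAdjoint (Matrix (Fin 2) (Fin 2) ℂ)) :
    Prop :=
  ∀ Z T S, expMap Z = triple (expMap ((2 : ℝ)⁻¹ • T)) (expMap S) →
    expMap (f Z) = triple (expMap ((2 : ℝ)⁻¹ • f T)) (expMap (f S))

namespace PreservesExpTriple

/-- The image under `f` of the isosceles right triangle with legs along `x` and `y`, compared with
that of the triangle in which the two legs are interchanged. -/
theorem exists_cosh_eq (hf : PreservesExpTriple f) {x y m n : EuclideanSpace ℝ (Fin 3)} {a b : ℝ}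
    (hx : ‖x‖ = 1) (hy : ‖y‖ = 1) (hxy : inner ℝ x y = 0)
    (hfx : f (pauli x) = a • 1 + pauli m) (hfy : f (pauli y) = b • 1 + pauli n)
    {t : ℝ} (ht : 0 < t) :
    ∃ α β ρ : ℝ, 0 < β ∧ β < α ∧ 0 < ρ ∧ α ^ 2 + β ^ 2 = ρ ^ 2 ∧ Real.cosh ρ = Real.cosh t ^ 2 ∧
      (α * a + β * b = t * (a + b) ∧ α * b + β * a = t * (a + b)) ∧
      Real.cosh ‖α • m + β • n‖ = Real.cosh ‖t • m‖ * Real.cosh ‖t • n‖ +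
        sinhc (t • m) * sinhc (t • n) * inner ℝ (t • m) (t • n) ∧
      ‖α • m + β • n‖ = ‖α • n + β • m‖ := by
  obtain ⟨α, β, ρ, hβ, hαβ, hρ, hsq, hc, hZ⟩ := exists_triple_expMap_pauli_eq ht
  have key {x y m n : EuclideanSpace ℝ (Fin 3)} {a b : ℝ}
      (hx : ‖x‖ = 1) (hy : ‖y‖ = 1) (hxy : inner ℝ x y = 0)
      (hfx : f (pauli x) = a • 1 + pauli m) (hfy : f (pauli y) = b • 1 + pauli n) :
      α * a + β * b = t * a + t * b ∧
      Real.cosh ‖α • m + β • n‖ = Real.cosh ‖t • m‖ * Real.cosh ‖t • n‖ +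
        sinhc (t • m) * sinhc (t • n) * inner ℝ (t • m) (t • n) := by
    apply eq_add_and_cosh_eq_of_expMap_eq_triple
    convert hf _ _ _ (hZ x y hx hy hxy) using 3
    · rw [map_add, map_add, map_smul, map_smul, map_add, map_smul, map_smul, map_smul, map_smul,
        hfx, hfy]
      module
    · rw [map_smul, map_smul, map_smul, hfx]
      module
    · rw [map_smul, map_smul, map_smul, hfy]
      module
  obtain ⟨h1, h2⟩ := key hx hy hxy hfx hfy
  obtain ⟨h3, h4⟩ := key hy hx ((real_inner_comm _ _).trans hxy) hfy hfx
  refine ⟨α, β, ρ, hβ, hαβ, hρ, hsq, hc, ⟨by linarith, by linarith⟩, h2, ?_⟩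
  rw [real_inner_comm] at h4
  rw [← abs_norm (α • m + β • n), ← abs_norm (α • n + β • m)]
  refine le_antisymm (Real.cosh_le_cosh.mp ?_) (Real.cosh_le_cosh.mp ?_) <;>
    rw [h2, h4] <;> apply le_of_eq <;> ring

theorem norm_eq_and_scalar_eq (hf : PreservesExpTriple f) {x y m n : EuclideanSpace ℝ (Fin 3)}
    {a b : ℝ} (hx : ‖x‖ = 1) (hy : ‖y‖ = 1) (hxy : inner ℝ x y = 0)
    (hfx : f (pauli x) = a • 1 + pauli m) (hfy : f (pauli y) = b • 1 + pauli n) :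
    ‖m‖ = ‖n‖ ∧ a = b := by
  obtain ⟨α, β, ρ, hβ, hαβ, -, -, -, ⟨h1, h2⟩, -, h3⟩ :=
    hf.exists_cosh_eq hx hy hxy hfx hfy one_pos
  constructor
  · have h4 := congrArg (· ^ 2) h3
    simp only [norm_add_sq_real, inner_smul_left, inner_smul_right, norm_smul, mul_pow,
      Real.norm_eq_abs, sq_abs, real_inner_comm n m] at h4
    have h5 : (α ^ 2 - β ^ 2) * (‖m‖ ^ 2 - ‖n‖ ^ 2) = 0 := by
      simp at h4
      linarith
    have h6 : α ^ 2 - β ^ 2 ≠ 0 := by nlinarith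
    refine (pow_left_inj₀ (norm_nonneg _) (norm_nonneg _) two_ne_zero).mp ?_
    linarith [(mul_eq_zero.mp h5).resolve_left h6]
  · have h5 : (α - β) * (a - b) = 0 := by linarith
    linarith [(mul_eq_zero.mp h5).resolve_left (sub_ne_zero.mpr hαβ.ne')]

theorem scalar_eq_zero (hf : PreservesExpTriple f) {x y m n : EuclideanSpace ℝ (Fin 3)}
    {a b : ℝ} (hx : ‖x‖ = 1) (hy : ‖y‖ = 1) (hxy : inner ℝ x y = 0)
    (hfx : f (pauli x) = a • 1 + pauli m) (hfy : f (pauli y) = b • 1 + pauli n) :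
    a = 0 := by
  have h1 := (hf.norm_eq_and_scalar_eq hx hy hxy hfx hfy).2
  have h2 : f (pauli (-y)) = (-b) • 1 + pauli (-n) := by
    rw [map_neg, map_neg, hfy, map_neg]; module
  have h3 := (hf.norm_eq_and_scalar_eq hx (by rwa [norm_neg])
    (by rw [inner_neg_right, hxy, neg_zero]) hfx h2).2
  linarith

theorem inner_eq_zero (hf : PreservesExpTriple f) {x y m n : EuclideanSpace ℝ (Fin 3)}
    (hx : ‖x‖ = 1) (hy : ‖y‖ = 1) (hxy : inner ℝ x y = 0)
    (hfx : f (pauli x) = pauli m) (hfy : f (pauli y) = pauli n) :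
    inner ℝ m n = 0 := by
  -- The unit vectors `k • (x ± y)` are orthogonal, so their images have equal length.
  set k : ℝ := (√2)⁻¹
  have hk : k ^ 2 = 2⁻¹ := by rw [inv_pow, Real.sq_sqrt zero_le_two]
  have hnorm {ε : ℝ} (hε : ε ^ 2 = 1) : ‖k • (x + ε • y)‖ = 1 := by
    refine (pow_left_inj₀ (norm_nonneg _) zero_le_one two_ne_zero).mp ?_
    rw [norm_smul, mul_pow, norm_add_sq_real, norm_smul, inner_smul_right, hx, hy, hxy]
    simp [hε, hk]; norm_num
  have hin : inner ℝ (k • (x + (1 : ℝ) • y)) (k • (x + (-1 : ℝ) • y)) = 0 := by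
    simp [inner_smul_left, inner_smul_right, inner_add_left, inner_add_right, hxy, hx, hy,
      real_inner_comm x y]
  have hfk (ε : ℝ) : f (pauli (k • (x + ε • y))) = (0 : ℝ) • 1 + pauli (k • (m + ε • n)) := by
    simp only [map_smul, map_add, hfx, hfy, zero_smul, zero_add]
  have h := (hf.norm_eq_and_scalar_eq (hnorm (by norm_num)) (hnorm (by norm_num)) hin
    (hfk _) (hfk _)).1
  rw [norm_smul, norm_smul] at h
  have hk0 : ‖k‖ ≠ 0 := by simp [k]
  have h' := congrArg (· ^ 2) (mul_left_cancel₀ hk0 h)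
  simp [norm_add_sq_real] at h'
  linarith

theorem norm_eq_zero_or_one (hf : PreservesExpTriple f) {x y m n : EuclideanSpace ℝ (Fin 3)}
    (hx : ‖x‖ = 1) (hy : ‖y‖ = 1) (hxy : inner ℝ x y = 0)
    (hfx : f (pauli x) = pauli m) (hfy : f (pauli y) = pauli n) :
    ‖m‖ = 0 ∨ ‖m‖ = 1 := by
  have hfx' : f (pauli x) = (0 : ℝ) • 1 + pauli m := by rw [hfx]; module
  have hfy' : f (pauli y) = (0 : ℝ) • 1 + pauli n := by rw [hfy]; module
  have hmn := (hf.norm_eq_and_scalar_eq hx hy hxy hfx' hfy').1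
  have hin := hf.inner_eq_zero hx hy hxy hfx hfy
  refine eq_zero_or_eq_one_of_cosh_eq_sq (norm_nonneg m) fun t ht => ?_
  obtain ⟨α, β, ρ, hβ, hαβ, hρ, hsq, hc, -, h, -⟩ := hf.exists_cosh_eq hx hy hxy hfx' hfy' ht
  refine ⟨ρ, hρ, hc, ?_⟩
  have hnorm : ‖α • m + β • n‖ = ‖m‖ * ρ := by
    refine (pow_left_inj₀ (norm_nonneg _) (by positivity) two_ne_zero).mp ?_
    rw [mul_pow, ← hsq, norm_add_sq_real, norm_smul, norm_smul, inner_smul_left, inner_smul_right,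
      hin, ← hmn, mul_pow, mul_pow, Real.norm_eq_abs, Real.norm_eq_abs, sq_abs, sq_abs]
    ring
  rw [hnorm, inner_smul_left, inner_smul_right, hin, norm_smul, norm_smul, ← hmn,
    Real.norm_of_nonneg ht.le] at h
  rw [h, mul_comm t]
  ring

/-- If the image of `f` on traceless matrices is at least two-dimensional, then `f 1` is scalar.
Scalar matrices commute with everything, so the vector part `u` of `f 1` and any image vector `k`
span a triangle with third side `u + k` at every scale; take `k` orthogonal to `u`. -/
theorem vectorPart_map_one_eq_zero (hf : PreservesExpTriple f)
    {x y m n u : EuclideanSpace ℝ (Fin 3)} {c : ℝ} (hm : ‖m‖ = 1) (hn : ‖n‖ = 1)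
    (hmn : inner ℝ m n = 0)
    (hfx : f (pauli x) = pauli m) (hfy : f (pauli y) = pauli n) (hfu : f 1 = c • 1 + pauli u) :
    u = 0 := by
  obtain ⟨w, k, hfw, huk, hk⟩ : ∃ w k : EuclideanSpace ℝ (Fin 3),
      f (pauli w) = pauli k ∧ inner ℝ u k = 0 ∧ k ≠ 0 := by
    by_cases hum : inner ℝ u m = 0
    · exact ⟨x, m, hfx, hum, by rintro rfl; simp at hm⟩
    refine ⟨inner ℝ u n • x - inner ℝ u m • y, inner ℝ u n • m - inner ℝ u m • n, ?_, ?_, ?_⟩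
    · simp only [map_sub, map_smul, hfx, hfy]
    · rw [inner_sub_right, inner_smul_right, inner_smul_right]; ring
    · intro h0
      have := congrArg (fun z => inner ℝ z n) h0
      simp [inner_sub_left, inner_smul_left, hmn, hn, hum] at this
  have h := eq_zero_or_eq_zero_of_cosh_mul (r := ‖u + k‖) (norm_nonneg u) (norm_nonneg k) (by
    rw [norm_add_sq_real, huk]; ring) fun s hs => by
      have hexp : expMap (s • 1 + pauli (s • w)) =
          triple (expMap ((2 : ℝ)⁻¹ • s • 1)) (expMap (pauli (s • w))) := by
        apply Subtype.ext
        have e : (expMap ((2 : ℝ)⁻¹ • s • 1) : PosDefCone 2).1 =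
            Real.exp (2⁻¹ * s) • (1 : Matrix (Fin 2) (Fin 2) ℂ) := by
          have := coe_expMap_smul_one_add_pauli (2⁻¹ * s) 0
          simpa [smul_smul] using this
        simp only [triple]
        rw [e, coe_expMap_smul_one_add_pauli, coe_expMap]
        simp only [smul_mul_assoc, one_mul, mul_smul_comm, mul_one, smul_smul]
        rw [← Real.exp_add]
        congr 2
        ring
      have h2 := hf _ _ _ hexp
      have h3 : expMap ((s * c) • 1 + pauli (s • (u + k))) =
          triple (expMap ((2 : ℝ)⁻¹ • ((s * c) • 1 + pauli (s • u))))
            (expMap ((0 : ℝ) • 1 + pauli (s • k))) := by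
        convert h2 using 3
        · simp only [map_add, map_smul, hfu, hfw]; module
        · simp only [map_smul, hfu]; module
        · simp only [map_smul, hfw]; module
      have h4 := (eq_add_and_cosh_eq_of_expMap_eq_triple h3).2
      rw [inner_smul_left, inner_smul_right, huk, norm_smul, norm_smul, norm_smul,
        Real.norm_of_nonneg hs.le] at h4
      simpa using h4
  exact norm_eq_zero.mp (h.resolve_right (norm_ne_zero_iff.mpr hk))

end PreservesExpTriple

end

open PosDefCone

/-- On traceless matrices `f` is either zero or an isometry in Pauli coordinates, and in the latter
case `f 1` is scalar. -/
theorem PreservesExpTriple.eq_zero_or_orthonormal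
    {f : selfAdjoint (Matrix (Fin 2) (Fin 2) ℂ) →ₗ[ℝ] selfAdjoint (Matrix (Fin 2) (Fin 2) ℂ)}
    (hf : PreservesExpTriple f) :
    (∀ v, f (pauli v) = 0) ∨
    ∃ (c : ℝ) (m : Fin 3 → EuclideanSpace ℝ (Fin 3)), Orthonormal ℝ m ∧ f 1 = c • 1 ∧
      ∀ v, f (pauli v) = pauli (∑ i, v i • m i) := by
  set e : Fin 3 → EuclideanSpace ℝ (Fin 3) := fun i => EuclideanSpace.single i 1 with he
  have hon : Orthonormal ℝ e := EuclideanSpace.orthonormal_single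
  have hexp (v : EuclideanSpace ℝ (Fin 3)) : v = ∑ i, v i • e i := by
    ext j
    simp [he, Fin.sum_univ_three]
    fin_cases j <;> simp
  choose a m hm using fun i => exists_eq_smul_one_add_pauli (f (pauli (e i)))
  have hne (i : Fin 3) : ∃ j, i ≠ j := ⟨i + 1, by fin_cases i <;> decide⟩
  have hm' (i : Fin 3) : f (pauli (e i)) = pauli (m i) := by
    obtain ⟨j, hij⟩ := hne i
    have := hf.scalar_eq_zero (hon.1 i) (hon.1 j) (hon.2 hij) (hm i) (hm j)
    rw [hm i, this]
    module
  have hfv (v : EuclideanSpace ℝ (Fin 3)) : f (pauli v) = pauli (∑ i, v i • m i) := by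
    conv_lhs => rw [hexp v]
    simp only [map_sum, map_smul, hm']
  have heq (i j : Fin 3) (hij : i ≠ j) : ‖m i‖ = ‖m j‖ :=
    (hf.norm_eq_and_scalar_eq (hon.1 i) (hon.1 j) (hon.2 hij) (hm i) (hm j)).1
  have hall (i : Fin 3) : ‖m i‖ = ‖m 0‖ := by
    by_cases hi : i = 0
    · rw [hi]
    · exact heq i 0 hi
  have h01 : (0 : Fin 3) ≠ 1 := by decide
  have horth (i j : Fin 3) (hij : i ≠ j) : inner ℝ (m i) (m j) = 0 :=
    hf.inner_eq_zero (hon.1 i) (hon.1 j) (hon.2 hij) (hm' i) (hm' j)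
  rcases hf.norm_eq_zero_or_one (hon.1 0) (hon.1 1) (hon.2 h01) (hm' 0) (hm' 1) with h | h
  · left
    intro v
    have (i : Fin 3) : m i = 0 := norm_eq_zero.mp ((hall i).trans h)
    simp [hfv, this]
  · right
    obtain ⟨c, u, hu⟩ := exists_eq_smul_one_add_pauli (f 1)
    have hu0 := hf.vectorPart_map_one_eq_zero h ((hall 1).trans h) (horth 0 1 h01) (hm' 0) (hm' 1)
      hu
    refine ⟨c, m, ⟨fun i => (hall i).trans h, fun i j hij => horth i j hij⟩, ?_, hfv⟩
    rw [hu, hu0, map_zero, add_zero]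

/-! ### Isometries of three-space as unitary conjugations -/

open Matrix in
theorem pauli_mem_unitaryGroup {x : EuclideanSpace ℝ (Fin 3)} (hx : ‖x‖ = 1) :
    (pauli x).1 ∈ unitaryGroup (Fin 2) ℂ := by
  rw [mem_unitaryGroup_iff, (pauli x).2.star_eq, pauli_mul_self, hx]
  simp

open Matrix in
theorem exists_unitary_conj_pauli {m : EuclideanSpace ℝ (Fin 3)} (hm : ‖m‖ = 1) :
    ∃ U ∈ unitaryGroup (Fin 2) ℂ, (pauli m).1 = U * (pauli !₂[0, 0, 1]).1 * star U := by
  set x : EuclideanSpace ℝ (Fin 3) := !₂[0, 0, 1] with hxdef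
  have hx : ‖x‖ = 1 := by
    refine (pow_left_inj₀ (norm_nonneg _) zero_le_one two_ne_zero).mp ?_
    rw [norm_sq_eq_coords]; simp [x]
  suffices h : ∃ y : EuclideanSpace ℝ (Fin 3), ‖y‖ = 1 ∧
      (pauli y).1 * (pauli x).1 = (pauli m).1 * (pauli y).1 by
    obtain ⟨y, hy, hyx⟩ := h
    refine ⟨_, pauli_mem_unitaryGroup hy, ?_⟩
    rw [hyx, (pauli y).2.star_eq, mul_assoc, pauli_mul_self, hy]
    simp
  -- The half-turn about the bisector of `m` and `x` exchanges them, unless they are antipodal.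
  by_cases h0 : m + x = 0
  · have hmx : m = -x := eq_neg_of_add_eq_zero_left h0
    refine ⟨!₂[1, 0, 0], ?_, ?_⟩
    · refine (pow_left_inj₀ (norm_nonneg _) zero_le_one two_ne_zero).mp ?_
      rw [norm_sq_eq_coords]; simp
    · have := pauli_mul_add_pauli_mul !₂[1, 0, 0] x
      rw [inner_eq_coords] at this
      simp only [hxdef] at this
      rw [hmx, map_neg]
      simp only [AddSubgroup.coe_neg, neg_mul]
      refine eq_neg_of_add_eq_zero_left ?_
      simpa using this
  · refine ⟨‖m + x‖⁻¹ • (m + x), norm_smul_inv_norm h0, ?_⟩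
    have h1 := pauli_mul_self m
    have h2 := pauli_mul_self x
    rw [hm] at h1
    rw [hx] at h2
    simp only [map_smul, map_add, selfAdjoint.val_smul, AddSubgroup.coe_add, smul_mul_assoc,
      mul_smul_comm, add_mul, mul_add, h1, h2]
    rw [add_comm (1 ^ 2 • _)]

theorem mul_add_mul_eq_zero_of_conj {R : Type*} [Ring R] [StarRing R] {U A B : R}
    (hU : star U * U = 1)
    (h : U * A * star U * (U * B * star U) + U * B * star U * (U * A * star U) = 0) :
    A * B + B * A = 0 := by
  have e : star U * (U * A * star U * (U * B * star U) + U * B * star U * (U * A * star U)) * U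
      = (star U * U) * A * (star U * U) * B * (star U * U) +
        (star U * U) * B * (star U * U) * A * (star U * U) := by noncomm_ring
  rw [h, hU] at e
  simpa using e.symm

open Matrix in
/-- An isometry of `ℝ³` is, up to sign, implemented in Pauli coordinates by a unitary conjugation.
A unitary carries `σ₃` to the image of the third basis vector, a diagonal unitary then adjusts the
image of `σ₁`, and anticommutation leaves only a sign for `σ₂`. If that sign is negative, an extra
factor `σ₂` in the unitary makes all three signs negative. -/
theorem exists_unitary_conj_pauli_of_orthonormal {m : Fin 3 → EuclideanSpace ℝ (Fin 3)}
    (hm : Orthonormal ℝ m) : ∃ U ∈ unitaryGroup (Fin 2) ℂ,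
      (∀ v : EuclideanSpace ℝ (Fin 3),
        (pauli (∑ i, v i • m i)).1 = U * (pauli v).1 * star U) ∨
      (∀ v : EuclideanSpace ℝ (Fin 3),
        (pauli (∑ i, v i • m i)).1 = -(U * (pauli v).1 * star U)) := by
  set s1 := (pauli !₂[1, 0, 0]).1 with hs1
  set s2 := (pauli !₂[0, 1, 0]).1 with hs2
  set s3 := (pauli !₂[0, 0, 1]).1 with hs3
  have es1 : s1 = !![0, 1; 1, 0] := by simp [hs1, coe_pauli]
  have es2 : s2 = !![0, -Complex.I; Complex.I, 0] := by simp [hs2, coe_pauli]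
  have es3 : s3 = !![1, 0; 0, -1] := by simp [hs3, coe_pauli]
  have hpauli (v : EuclideanSpace ℝ (Fin 3)) :
      (pauli v).1 = v 0 • s1 + v 1 • s2 + v 2 • s3 := by
    rw [es1, es2, es3, coe_pauli]
    ext i j
    fin_cases i <;> fin_cases j <;> simp [sub_eq_add_neg]
  have hsum (v : EuclideanSpace ℝ (Fin 3)) : (pauli (∑ i, v i • m i)).1 =
      v 0 • (pauli (m 0)).1 + v 1 • (pauli (m 1)).1 + v 2 • (pauli (m 2)).1 := by
    rw [Fin.sum_univ_three]
    simp only [map_add, map_smul, AddSubgroup.coe_add, selfAdjoint.val_smul]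
  obtain ⟨U, hU, hU2⟩ := exists_unitary_conj_pauli (hm.1 2)
  have hUU : star U * U = 1 := mem_unitaryGroup_iff'.mp hU
  have hUU' : U * star U = 1 := mem_unitaryGroup_iff.mp hU
  -- Anticommuting with the image of `σ₃` means being off-diagonal in an eigenbasis of that image.
  have form {U : Matrix (Fin 2) (Fin 2) ℂ} (hUU : star U * U = 1) (hUU' : U * star U = 1)
      (hU2 : (pauli (m 2)).1 = U * s3 * star U) (i : Fin 3) (hi : i ≠ 2) :
      ∃ w : ℂ, w * star w = 1 ∧ (pauli (m i)).1 = U * !![0, star w; w, 0] * star U := by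
    set T := star U * (pauli (m i)).1 * U with hT
    have hback : (pauli (m i)).1 = U * T * star U := by
      rw [hT]
      simp only [mul_assoc, hUU', mul_one]
      simp only [← mul_assoc, hUU', one_mul]
    have hTs : star T = T := by
      rw [hT, star_mul, star_mul, star_star, (pauli (m i)).2.star_eq, mul_assoc]
    have hTT : T * T = 1 := by
      have : T * T = star U * ((pauli (m i)).1 * (U * star U) * (pauli (m i)).1) * U := by
        rw [hT]; noncomm_ring
      rw [this, hUU', mul_one, pauli_mul_self, hm.1 i]
      simp [hUU]
    have hT3 : T * s3 + s3 * T = 0 := by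
      have h := pauli_mul_add_pauli_mul (m i) (m 2)
      rw [hm.2 hi, hback, hU2, mul_zero, zero_smul] at h
      exact mul_add_mul_eq_zero_of_conj hUU h
    have t00 : T 0 0 = 0 := by
      have := congrFun (congrFun hT3 0) 0
      simp only [es3, Matrix.add_apply, mul_apply, Fin.sum_univ_two] at this
      simp at this
      exact this
    have t11 : T 1 1 = 0 := by
      have := congrFun (congrFun hT3 1) 1
      simp only [es3, Matrix.add_apply, mul_apply, Fin.sum_univ_two] at this
      simp at this
      exact this
    have t01 := congrFun (congrFun hTs 0) 1
    simp only [star_apply] at t01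
    have tn := congrFun (congrFun hTT 1) 1
    simp only [mul_apply, Fin.sum_univ_two, t11, ← t01, one_apply_eq, mul_zero, add_zero] at tn
    refine ⟨T 1 0, tn, ?_⟩
    conv_lhs => rw [hback]
    congr 2
    ext i j
    fin_cases i <;> fin_cases j
    exacts [t00, t01.symm, rfl, t11]
  obtain ⟨w, hw, hw0⟩ := form hUU hUU' hU2 0 (by decide)
  set D : Matrix (Fin 2) (Fin 2) ℂ := !![1, 0; 0, w] with hD
  have hw' : w * (starRingEnd ℂ) w = 1 := hw
  have hDs : star D = !![1, 0; 0, star w] := by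
    ext i j; fin_cases i <;> fin_cases j <;> simp [hD, star_apply]
  have hDD : D * star D = 1 := by
    rw [hDs, hD]
    ext i j; fin_cases i <;> fin_cases j <;> simp [hw']
  have hD1 : D * s1 * star D = !![0, star w; w, 0] := by
    rw [hDs, hD, es1]
    ext i j; fin_cases i <;> fin_cases j <;> simp
  have hD3 : D * s3 * star D = s3 := by
    rw [hDs, hD, es3]
    ext i j; fin_cases i <;> fin_cases j <;> simp [hw']
  set V := U * D with hV
  have hVu : V ∈ unitaryGroup (Fin 2) ℂ := mul_mem hU (mem_unitaryGroup_iff.mpr hDD)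
  have hVV : star V * V = 1 := mem_unitaryGroup_iff'.mp hVu
  have hVV' : V * star V = 1 := mem_unitaryGroup_iff.mp hVu
  have hconj (A : Matrix (Fin 2) (Fin 2) ℂ) : V * A * star V = U * (D * A * star D) * star U := by
    rw [hV, star_mul]; noncomm_ring
  have hV3 : (pauli (m 2)).1 = V * s3 * star V := by rw [hconj, hD3, hU2]
  have hV1 : (pauli (m 0)).1 = V * s1 * star V := by rw [hconj, hD1, hw0]
  obtain ⟨z, hz, hz1⟩ := form hVV hVV' hV3 1 (by decide)
  set R : Matrix (Fin 2) (Fin 2) ℂ := !![0, star z; z, 0] with hR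
  have hR1 : R * s1 + s1 * R = 0 := by
    have h := pauli_mul_add_pauli_mul (m 1) (m 0)
    rw [hm.2 (by decide), hz1, hV1, mul_zero, zero_smul] at h
    exact mul_add_mul_eq_zero_of_conj hVV h
  have hzre : star z = -z := by
    have := congrFun (congrFun hR1 0) 0
    simp [hR, es1] at this
    exact eq_neg_of_add_eq_zero_left this
  have hzI : z = Complex.I ∨ z = -Complex.I := by
    rw [hzre] at hz
    refine sq_eq_sq_iff_eq_or_eq_neg.mp ?_
    rw [Complex.I_sq]
    linear_combination -hz
  rcases hzI with rfl | rfl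
  · refine ⟨V, hVu, .inl fun v => ?_⟩
    have : R = s2 := by rw [hR, es2]; simp
    rw [hsum, hpauli v, hV1, hV3, hz1, this]
    simp only [mul_add, add_mul, mul_smul_comm, smul_mul_assoc]
  · have hRs : R = -s2 := by rw [hR, es2]; simp
    have hs2u : s2 ∈ unitaryGroup (Fin 2) ℂ := pauli_mem_unitaryGroup (by
      refine (pow_left_inj₀ (norm_nonneg _) zero_le_one two_ne_zero).mp ?_
      rw [norm_sq_eq_coords]; simp)
    refine ⟨V * s2, mul_mem hVu hs2u, .inr fun v => ?_⟩
    have hs2s : star s2 = s2 := (pauli _).2.star_eq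
    have e1 : s2 * s1 * s2 = -s1 := by rw [es1, es2]; simp
    have e2 : s2 * s2 * s2 = s2 := by rw [es2]; simp
    have e3 : s2 * s3 * s2 = -s3 := by rw [es3, es2]; simp
    have hc (A : Matrix (Fin 2) (Fin 2) ℂ) :
        V * s2 * A * star (V * s2) = V * (s2 * A * s2) * star V := by
      rw [star_mul, hs2s]; noncomm_ring
    rw [hsum, hpauli v, hV1, hV3, hz1, hRs, hc]
    simp only [mul_add, add_mul, mul_smul_comm, smul_mul_assoc, e1, e2, e3, mul_neg, neg_mul,
      smul_neg, neg_add, neg_neg]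

/-! ### Classification -/

theorem realDet_expMap_rpow (a c : ℝ) (v : EuclideanSpace ℝ (Fin 3)) :
    (expMap (a • 1 + pauli v)).realDet ^ c = Real.exp (2 * a * c) := by
  have h : (expMap (a • 1 + pauli v)).realDet = Real.exp (2 * a) := by
    rw [realDet, det_expMap, Complex.ofReal_re]
  rw [h, ← Real.exp_mul]

theorem IsJordanTripleEndomorphism.preservesExpTriple {φ : PosDefCone 2 → PosDefCone 2}
    (hφ : IsJordanTripleEndomorphism φ)
    {f : selfAdjoint (Matrix (Fin 2) (Fin 2) ℂ) →ₗ[ℝ] selfAdjoint (Matrix (Fin 2) (Fin 2) ℂ)}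
    (hf : ∀ T, φ (expMap T) = expMap (f T)) : PreservesExpTriple f := by
  intro Z T S h
  rw [← hf, h, hφ.map_triple, hf, hf, map_smul]

theorem exp_unitary_conj {n : ℕ} {U : Matrix (Fin n) (Fin n) ℂ}
    (hU : U ∈ Matrix.unitaryGroup (Fin n) ℂ)
    (X : Matrix (Fin n) (Fin n) ℂ) : exp (U * X * star U) = U * exp X * star U := by
  have hinv : U⁻¹ = star U := Matrix.inv_eq_right_inv (Matrix.mem_unitaryGroup_iff.mp hU)
  have hu : IsUnit U := IsUnit.of_mul_eq_one _ (Matrix.mem_unitaryGroup_iff.mp hU)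
  rw [← hinv, Matrix.exp_conj U X hu]

theorem theorem1 (φ : PosDefCone 2 → PosDefCone 2) (hcont : Continuous φ)
    (hφ : IsJordanTripleEndomorphism φ) :
    (∃ U ∈ Matrix.unitaryGroup (Fin 2) ℂ, ∃ c : ℝ, ∀ A : PosDefCone 2,
      (φ A).1 = ((A.realDet ^ c : ℝ) : ℂ) • (U * A.1 * U.conjTranspose)) ∨
    (∃ V ∈ Matrix.unitaryGroup (Fin 2) ℂ, ∃ d : ℝ, ∀ A : PosDefCone 2,
      (φ A).1 = ((A.realDet ^ d : ℝ) : ℂ) • (V * A.1⁻¹ * V.conjTranspose)) ∨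
    (∃ W ∈ Matrix.unitaryGroup (Fin 2) ℂ, ∃ c₁ c₂ : ℝ, ∀ A : PosDefCone 2,
      (φ A).1 = W * Matrix.diagonal ![((A.realDet ^ c₁ : ℝ) : ℂ), ((A.realDet ^ c₂ : ℝ) : ℂ)] *
        W.conjTranspose) := by
  obtain ⟨f, hf⟩ := hφ.exists_linearMap hcont
  have hA (A : PosDefCone 2) : ∃ (a : ℝ) (v : EuclideanSpace ℝ (Fin 3)),
      A = expMap (a • 1 + pauli v) := by
    obtain ⟨a, v, h⟩ := exists_eq_smul_one_add_pauli (logMap A)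
    exact ⟨a, v, by rw [← h, expMap_logMap]⟩
  rcases (hφ.preservesExpTriple hf).eq_zero_or_orthonormal with h0 | ⟨c, m, hm, h1, hv⟩
  · right; right
    have hH : (f 1).1.IsHermitian := (f 1).2
    refine ⟨hH.eigenvectorUnitary, hH.eigenvectorUnitary.2, hH.eigenvalues 0 / 2,
      hH.eigenvalues 1 / 2, fun A => ?_⟩
    obtain ⟨a, v, rfl⟩ := hA A
    rw [hf, map_add, h0, add_zero, map_smul, coe_expMap, selfAdjoint.val_smul,
      realDet_expMap_rpow, realDet_expMap_rpow]
    have hs := hH.spectral_theorem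
    rw [Unitary.conjStarAlgAut_apply] at hs
    have hs' : a • (f 1).1 = hH.eigenvectorUnitary.1 *
        (a • Matrix.diagonal (RCLike.ofReal ∘ hH.eigenvalues)) * star hH.eigenvectorUnitary.1 := by
      conv_lhs => rw [hs]
      simp
    rw [hs', exp_unitary_conj hH.eigenvectorUnitary.2, ← Matrix.diagonal_smul, Matrix.exp_diagonal,
      Matrix.star_eq_conjTranspose]
    congr 3
    ext i
    rw [Pi.coe_exp]
    fin_cases i <;> simp [← Complex.exp_eq_exp_ℂ] <;> ring_nf
  · obtain ⟨U, hU, h | h⟩ := exists_unitary_conj_pauli_of_orthonormal hm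
    · left
      refine ⟨U, hU, (c - 1) / 2, fun A => ?_⟩
      obtain ⟨a, v, rfl⟩ := hA A
      rw [hf, map_add, map_smul, h1, hv, smul_smul, coe_expMap_smul_one_add_pauli, h,
        exp_unitary_conj hU, realDet_expMap_rpow, coe_expMap_smul_one_add_pauli,
        Complex.coe_smul, mul_smul_comm, smul_mul_assoc, smul_smul, ← Real.exp_add,
        Matrix.star_eq_conjTranspose]
      congr 2
      ring
    · right; left
      refine ⟨U, hU, (c + 1) / 2, fun A => ?_⟩
      obtain ⟨a, v, rfl⟩ := hA A
      have hinv : (expMap (a • 1 + pauli v)).1⁻¹ = Real.exp (-a) • exp (-(pauli v).1) := by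
        have e : -(a • 1 + pauli v : selfAdjoint (Matrix (Fin 2) (Fin 2) ℂ)).1 =
            (-a) • 1 + -(pauli v).1 := by
          simp [add_comm]
        rw [coe_expMap, ← Matrix.exp_neg, e, exp_smul_one_add]
      rw [hf, map_add, map_smul, h1, hv, smul_smul, coe_expMap_smul_one_add_pauli, h, hinv,
        ← neg_mul, ← mul_neg,
        exp_unitary_conj hU, realDet_expMap_rpow,
        Complex.coe_smul, mul_smul_comm, smul_mul_assoc, smul_smul, ← Real.exp_add,
        Matrix.star_eq_conjTranspose]
      congr 2
      ring
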